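/- Let $p\in\mathbb N$, $\mathcal X=[0,1]^p$, and let $P_X$ be a probability measure on $\mathcal X$ that is absolutely continuous with respect to Lebesgue measure. **Function class.** $\mathcal W^{(1,1)}_{\mathrm{mix}}(\mathcal X)$ is the set of $f\in L^1(\mathcal X)$ such that for every $\alpha\in\{0,1\}^p$ the weak mixed derivative $D_\alpha f$ exists and lies in $L^1(\mathcal X)$, i.e. $\int_{\mathcal X} f\,\partial^\alpha\varphi\,dx=(-1)^{\|\alpha\|_1}\int_{\mathcal X} (D_\alpha f)\,\varphi\,dx$ for all $\varphi\in C_c^\infty((0,1)^p)$. Such an $f$ is *anchored at zero* if it has zero trace on each face $\{x_j=0\}$: $\lim_{\varepsilon\downarrow0}\frac1\varepsilon\int_{\{x\in\mathcal X:\,x_j\le\varepsilon\}}|f|\,dx=0$ for every $j$. If $f$ is continuous on $\mathcal X$ (in particular for a continuous representative), this means exactly that $f(x)=0$ whenever $x_j=0$ for some $j$. **Dictionary.** $\mathcal D_p^+\subset L^2(P_X)$ is the set of all $g(x)=\prod_{j=1}^p h_j(x_j)$ with $g\ge 0$ on $\mathcal X$ and $\|g\|_{L^2(P_X)}=1$,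 where each $h_j:[0,1]\to\mathbb R$ is a finite linear combination of indicators of intervals covering $[0,1]$. **Orthogonal greedy algorithm (OGA).** Let $\theta\in(0,1]$ and $f\in L^2(P_X)$. An $r$-step OGA run with selection parameter $\theta$ consists of $f_0=0$ and, for $\ell=1,\dots,r$, an atom $g_\ell\in\mathcal D_p^+$ with $$|\langle f-f_{\ell-1},g_\ell\rangle|\ \ge\ \theta\,\sup_{g\in\mathcal D_p^+}|\langle f-f_{\ell-1},g\rangle|,$$ together with the orthogonal projection $f_\ell$ of $f$ onto $\mathrm{span}\{g_1,\dots,g_\ell\}$ in $L^2(P_X)$. For $\theta=1$ this is exact greedy selection, $g_\ell\in\arg\max_{g\in\mathcal D_p^+}|\langle f-f_{\ell-1},g\rangle|$. **Claim.** Let $f\in\mathcal W^{(1,1)}_{\mathrm{mix}}(\mathcal X)$ be anchored at zero. Then $f\in L^2(P_X)$, and for every $\theta\in[\tfrac12,1]$ the following holds. 1. If $\theta<1$, then an $r$-step OGA run for $f$ with selection parameter $\theta$ exists for every $r\ge 0$. 2. For every $r\ge1$ and every $r$-step OGA run for $f$ with selection parameter $\theta$ (in particular every exact greedy run, $\theta=1$),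 $$\|f-f_r\|_{L^2(P_X)}\ \le\ \frac{2\,\|D_{(1,\dots,1)}f\|_{L^1(\mathcal X)}}{\sqrt r}.$$ -/

import Mathlib

open MeasureTheory Set Filter Topology

/-- The unit cube `[0,1]^p`. -/
def unitCube (p : ℕ) : Set (Fin p → ℝ) := Icc 0 1

/-! ### Sobolev space of dominant mixed smoothness -/

/-- The classical partial derivative `∂φ/∂x_j`. -/
noncomputable def partialDeriv {p : ℕ} (j : Fin p) (φ : (Fin p → ℝ) → ℝ) : (Fin p → ℝ) → ℝ :=
  fun x => fderiv ℝ φ x (Pi.single j 1)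

/-- The classical mixed partial derivative `∂^{|S|}φ / ∏_{j ∈ S} ∂x_j`: every variable with index
in `S` is differentiated exactly once. A multi-index `α ∈ {0,1}^p` is encoded by its support `S`. -/
noncomputable def mixedPartial {p : ℕ} (S : Finset (Fin p)) (φ : (Fin p → ℝ) → ℝ) :
    (Fin p → ℝ) → ℝ :=
  ((List.finRange p).filter (· ∈ S)).foldr partialDeriv φ

/-- Test functions on the open cube: smooth, with compact support contained in `(0,1)^p`. -/
structure IsTestFunction {p : ℕ} (φ : (Fin p → ℝ) → ℝ) : Prop where
  contDiff : ContDiff ℝ (⊤ : ℕ∞) φ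
  hasCompactSupport : HasCompactSupport φ
  tsupport_subset : tsupport φ ⊆ univ.pi fun _ => Ioo 0 1

/-- `g ∈ L¹([0,1]^p)` is a version of the weak mixed derivative `D_α f` of `f ∈ L¹([0,1]^p)`,
where `α ∈ {0,1}^p` has support `S`. -/
structure IsWeakMixedDeriv {p : ℕ} (S : Finset (Fin p)) (f g : (Fin p → ℝ) → ℝ) : Prop where
  integrableOn : IntegrableOn f (unitCube p)
  integrableOn_deriv : IntegrableOn g (unitCube p)
  integral_eq : ∀ φ : (Fin p → ℝ) → ℝ, IsTestFunction φ →
    ∫ x in unitCube p, f x * mixedPartial S φ x =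
      (-1) ^ S.card * ∫ x in unitCube p, g x * φ x

/-- Membership in `W_mix^{(1,1)}([0,1]^p)`: for every `α ∈ {0,1}^p` the weak derivative `D_α f`
exists and belongs to `L¹([0,1]^p)`. -/
def MemWmix {p : ℕ} (f : (Fin p → ℝ) → ℝ) : Prop :=
  ∀ S : Finset (Fin p), ∃ g, IsWeakMixedDeriv S f g

/-- `f` is anchored at zero: its trace on each of the faces `{x_j = 0}` of the cube vanishes.
The pointwise values of a Sobolev function on these null sets are immaterial, so the condition is
expressed by averages over thin slabs. For the continuous representative it says exactly that
`f x = 0` whenever some `x_j = 0`; see `anchoredAtZero_iff`. -/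
def AnchoredAtZero {p : ℕ} (f : (Fin p → ℝ) → ℝ) : Prop :=
  ∀ j : Fin p,
    Tendsto (fun ε : ℝ => ε⁻¹ * ∫ x in {x ∈ unitCube p | x j ≤ ε}, |f x|) (𝓝[>] 0) (𝓝 0)

/-- For a function that is continuous on the cube, being anchored at zero has its pointwise
meaning. -/
theorem anchoredAtZero_iff {p : ℕ} {f : (Fin p → ℝ) → ℝ} (hf : ContinuousOn f (unitCube p)) :
    AnchoredAtZero f ↔ ∀ x ∈ unitCube p, (∃ j, x j = 0) → f x = 0 := by
  have hK : IsCompact (unitCube p) := isCompact_Icc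
  have hint : IntegrableOn (fun x => |f x|) (unitCube p) := hf.abs.integrableOn_compact hK
  constructor
  · rintro h y hy ⟨j, hyj⟩
    by_contra hne
    have ha : 0 < |f y| / 2 := by positivity
    obtain ⟨δ, hδ, hfδ⟩ := Metric.continuousOn_iff.1 hf y hy _ ha
    obtain ⟨d, hd0, hdδ⟩ : ∃ d : ℝ, 0 < d ∧ d < min δ (1 / 2) :=
      exists_between (lt_min hδ (by norm_num))
    have hd1 : d < δ := hdδ.trans_le (min_le_left _ _)
    have hd2 : d < 1 / 2 := hdδ.trans_le (min_le_right _ _)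
    let l : Fin p → ℝ := fun i => if y i ≤ 1 / 2 then y i else y i - d
    have hl : ∀ i, 0 ≤ l i ∧ l i + d ≤ 1 ∧ y i - d ≤ l i ∧ l i ≤ y i := by
      intro i
      have h1 : (0 : ℝ) ≤ y i := hy.1 i
      have h2 : y i ≤ 1 := hy.2 i
      by_cases hc : y i ≤ 1 / 2
      · simp only [l, if_pos hc]
        refine ⟨?_, ?_, ?_, ?_⟩ <;> linarith
      · simp only [l, if_neg hc]
        refine ⟨?_, ?_, ?_, ?_⟩ <;> linarith
    have hlj : l j = 0 := by simp [l, hyj]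
    let P : ℝ := ∏ _i ∈ Finset.univ.erase j, d
    have hP : 0 < P := Finset.prod_pos fun _ _ => hd0
    have key : ∀ ε ∈ Ioc (0 : ℝ) d, |f y| / 2 * P ≤
        ε⁻¹ * ∫ x in {x ∈ unitCube p | x j ≤ ε}, |f x| := by
      intro ε hε
      let u : Fin p → ℝ := fun i => if i = j then ε else l i + d
      have hlu : l ≤ u := by
        intro i
        by_cases hi : i = j
        · subst hi; simp only [u, if_true, hlj]; exact hε.1.le
        · simp only [u, if_neg hi]; linarith
      have hud : ∀ i, u i ≤ l i + d := by
        intro i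
        by_cases hi : i = j
        · subst hi; simp only [u, if_true, hlj]; linarith [hε.2]
        · simp only [u, if_neg hi]; exact le_rfl
      have hsub : Icc l u ⊆ {x ∈ unitCube p | x j ≤ ε} := by
        intro x hx
        refine ⟨⟨fun i => (hl i).1.trans (hx.1 i),
          fun i => (hx.2 i).trans ((hud i).trans (hl i).2.1)⟩, ?_⟩
        have := hx.2 j
        simpa [u] using this
      have hlow : ∀ x ∈ Icc l u, |f y| / 2 ≤ |f x| := by
        intro x hx
        have hdist : dist x y < δ := by
          refine lt_of_le_of_lt ((dist_pi_le_iff hd0.le).2 fun i => ?_) hd1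
          rw [Real.dist_eq, abs_le]
          have h1 := hx.1 i
          have h2 := (hx.2 i).trans (hud i)
          obtain ⟨-, -, h3, h4⟩ := hl i
          constructor <;> linarith
        have h5 := hfδ x (hsub hx).1 hdist
        rw [Real.dist_eq] at h5
        have h6 := abs_sub_abs_le_abs_sub (f y) (f x)
        rw [abs_sub_comm] at h6
        linarith
      have hvol : volume.real (Icc l u) = ε * P := by
        rw [Measure.real, Real.volume_Icc_pi_toReal hlu,
          ← Finset.mul_prod_erase Finset.univ _ (Finset.mem_univ j)]
        congr 1
        · simp [u, hlj]
        · refine Finset.prod_congr rfl fun i hi => ?_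
          simp [u, Finset.ne_of_mem_erase hi]
      have h1 : |f y| / 2 * volume.real (Icc l u) ≤ ∫ x in Icc l u, |f x| := by
        have := setIntegral_mono_on (μ := volume) (s := Icc l u) (f := fun _ => |f y| / 2)
          (integrableOn_const (isCompact_Icc.measure_lt_top.ne))
          (hint.mono_set (hsub.trans fun x hx => hx.1)) measurableSet_Icc hlow
        rwa [setIntegral_const, smul_eq_mul, mul_comm] at this
      have h2 : ∫ x in Icc l u, |f x| ≤ ∫ x in {x ∈ unitCube p | x j ≤ ε}, |f x| :=
        setIntegral_mono_set (hint.mono_set fun x hx => hx.1)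
          (Eventually.of_forall fun x => abs_nonneg _) hsub.eventuallyLE
      rw [hvol] at h1
      have h3 := h1.trans h2
      rw [inv_mul_eq_div, le_div_iff₀ hε.1]
      linarith
    have hev : ∀ᶠ ε in 𝓝[>] (0 : ℝ), ε ∈ Ioc (0 : ℝ) d := Ioc_mem_nhdsGT hd0
    have := ge_of_tendsto (h j) (hev.mono key)
    have hpos : 0 < |f y| / 2 * P := mul_pos ha hP
    linarith
  · intro h j
    have huc := hK.uniformContinuousOn_of_continuous hf
    rw [Metric.tendsto_nhdsWithin_nhds]
    intro η hη
    obtain ⟨δ, hδ, hfδ⟩ := Metric.uniformContinuousOn_iff.1 huc (η / 2) (by positivity)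
    refine ⟨min δ 1, lt_min hδ one_pos, ?_⟩
    intro ε hε hεδ
    have hε0 : 0 < ε := hε
    rw [Real.dist_eq, sub_zero, abs_of_pos hε0] at hεδ
    have hε1 : ε < δ := hεδ.trans_le (min_le_left _ _)
    let s : Set (Fin p → ℝ) := {x ∈ unitCube p | x j ≤ ε}
    have hup : ∀ x ∈ s, |f x| ≤ η / 2 := by
      rintro x ⟨hx, hxj⟩
      have hx0 : (0 : ℝ) ≤ x j := hx.1 j
      have hy : Function.update x j 0 ∈ unitCube p := by
        constructor <;> intro i <;> by_cases hi : i = j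
        · subst hi; simp
        · simpa [hi] using hx.1 i
        · subst hi; simp
        · simpa [hi] using hx.2 i
      have hdist : dist x (Function.update x j 0) < δ := by
        refine lt_of_le_of_lt ((dist_pi_le_iff hε0.le).2 fun i => ?_) hε1
        by_cases hi : i = j
        · subst hi
          simpa [Real.dist_eq, abs_of_nonneg hx0] using hxj
        · simpa [hi] using hε0.le
      have h1 := hfδ x hx _ hy hdist
      rw [h _ hy ⟨j, by simp⟩, Real.dist_eq, sub_zero] at h1
      exact h1.le
    have hs : s ⊆ Icc 0 (Function.update 1 j ε) := by
      rintro x ⟨hx, hxj⟩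
      refine ⟨hx.1, fun i => ?_⟩
      by_cases hi : i = j
      · subst hi; simpa using hxj
      · simpa [hi] using hx.2 i
    have hvol : volume.real s ≤ ε := by
      refine (measureReal_mono hs isCompact_Icc.measure_lt_top.ne).trans (le_of_eq ?_)
      rw [Measure.real, Real.volume_Icc_pi_toReal,
        ← Finset.mul_prod_erase Finset.univ _ (Finset.mem_univ j)]
      · rw [Finset.prod_eq_one]
        · simp
        · intro i hi
          simp [Finset.ne_of_mem_erase hi]
      · intro i
        by_cases hi : i = j
        · subst hi; simpa using hε0.le
        · simp [hi]
    have hnn : 0 ≤ ∫ x in s, |f x| := integral_nonneg fun x => abs_nonneg _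
    have hle : ∫ x in s, |f x| ≤ η / 2 * ε := by
      have hms : MeasurableSet s :=
        measurableSet_Icc.inter (measurableSet_le (measurable_pi_apply j) measurable_const)
      have hfin : volume s ≠ ⊤ := ((measure_mono hs).trans_lt isCompact_Icc.measure_lt_top).ne
      have := setIntegral_mono_on (μ := volume) (s := s) (g := fun _ => η / 2)
        (hint.mono_set fun x hx => hx.1) (integrableOn_const hfin) hms hup
      rw [setIntegral_const, smul_eq_mul, mul_comm] at this
      exact this.trans (mul_le_mul_of_nonneg_left hvol (by positivity))
    rw [Real.dist_eq, sub_zero, abs_of_nonneg (mul_nonneg (inv_nonneg.2 hε0.le) hnn),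
      inv_mul_eq_div, div_lt_iff₀ hε0]
    refine hle.trans_lt (mul_lt_mul_of_pos_right (by linarith) hε0)

/-! ### The dictionary of non-negative separable piecewise-constant functions -/

/-- `h` is piecewise constant on `[0,1]`: on `[0,1]` it is a finite linear combination of
indicators of intervals (order-connected sets, of any type) which cover `[0,1]`. -/
def IsPiecewiseConstant (h : ℝ → ℝ) : Prop :=
  ∃ (K : ℕ) (c : Fin K → ℝ) (I : Fin K → Set ℝ),
    (∀ k, (I k).OrdConnected) ∧ ⋃ k, I k = Icc 0 1 ∧
      ∀ t ∈ Icc (0 : ℝ) 1, h t = ∑ k, (I k).indicator (fun _ => c k) t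

/-- The dictionary `D_p^+ ⊆ L²(P)`: products `∏_j h_j(x_j)` of univariate piecewise-constant
functions which are non-negative on the cube and have unit norm in `L²(P)`. -/
def positiveDictionary {p : ℕ} (P : Measure (Fin p → ℝ)) : Set (Lp ℝ 2 P) :=
  {u | ∃ h : Fin p → ℝ → ℝ, (∀ j, IsPiecewiseConstant (h j)) ∧
    (∀ x ∈ unitCube p, 0 ≤ ∏ j, h j (x j)) ∧
    (u =ᵐ[P] fun x => ∏ j, h j (x j)) ∧ ‖u‖ = 1}

/-! ### The orthogonal greedy algorithm -/

/-- `g 0, …, g (r-1)` are the atoms selected in `r` steps of the orthogonal greedy algorithm for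
the target `f` over the dictionary `D`, and `F 0, …, F r` are the resulting approximations
(the values of `g` and `F` at other indices play no role).

At each step the correlation of the selected atom with the current residual is at least `θ` times
the correlation of every element of `D`; for `θ = 1` this is exact greedy selection, i.e. the atom
attains the maximum. `F k` is the orthogonal projection of `f` onto `span {g 0, …, g (k-1)}`;
in particular `F 0 = 0`. -/
structure IsOGA {H : Type*} [NormedAddCommGroup H] [InnerProductSpace ℝ H]
    (θ : ℝ) (D : Set H) (f : H) (r : ℕ) (g F : ℕ → H) : Prop where
  atom_mem : ∀ k < r, g k ∈ D
  greedy : ∀ k < r, ∀ d ∈ D, θ * |inner ℝ (f - F k) d| ≤ |inner ℝ (f - F k) (g k)|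
  approx_mem : ∀ k ≤ r, F k ∈ Submodule.span ℝ (g '' Iio k)
  residual_orthogonal : ∀ k ≤ r, ∀ v ∈ Submodule.span ℝ (g '' Iio k), inner ℝ (f - F k) v = 0

/-!
The rate is the one of the weak orthogonal greedy algorithm for targets of finite variation norm.

Put `F x = ∫_{[0,x]} c` with `c` the full mixed derivative. The equation defining `c` first gives
`f = F` almost everywhere (`AnchoredAtZero.ae_eq_cumulativeIntegral`). Indeed, tested against a
product `∏ uᵢ(xᵢ)` it reads `∫ f ∏ uᵢ' = (-1)^p ∫ c ∏ uᵢ`. Multiplying one factor at a time by a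
smooth cutoff at `0` and letting the cutoff tend to `1` costs a boundary term of size
`ε⁻¹ ∫_{xⱼ ≤ ε} |f|`, which vanishes because `f` is anchored; hence the identity persists when the
`uᵢ` vanish near `1` only (`AnchoredAtZero.integral_mul_prod_deriv`). Taking for `uᵢ` primitives of
arbitrary smooth functions vanishing near `1`, Fubini's theorem shows that `f` and `F` agree against
products of such functions, in the limit against indicators of boxes, and these form a generating
π-system.

Consequently `⟪v, f⟫ = ∫ c(y) ⟪v, 1_{[y,1]}⟫ dy` for every `v` in `L²(P)`. The indicator of a box is a
multiple, with factor at most `1`, of a dictionary element, so `⟪v, f⟫ ≤ ‖c‖₁ sup_d |⟪v, d⟫|`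
(`integral_mul_cumulativeIntegral_le`).

With `v` the residual `f - f_k`, for which `‖f - f_k‖² = ⟪f - f_k, f⟫`, this bounds the correlation
with the selected atom from below by `θ ‖f - f_k‖² / ‖c‖₁`. One step decreases `‖f - f_k‖²` by at
least the square of that correlation, and the resulting recursion gives the bound
`‖c‖₁ / (θ √r)` (`IsOGA.norm_sub_le`), which is at most `2 ‖c‖₁ / √r` for `θ ≥ 1 / 2`.
-/

/-! ### Convergence and existence of the orthogonal greedy algorithm -/

/-- The recursion behind the greedy rate: if each step decreases `a k` by at least `(b k) ^ 2`, and
`a k ≤ m * b k`, then `a k` decays like `m ^ 2 / k`. -/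
lemma mul_le_sq_of_greedy_recursion {a b : ℕ → ℝ} {m : ℝ} {r : ℕ} (hm : 0 ≤ m)
    (ha : ∀ k, 0 ≤ a k) (hstep : ∀ k < r, a (k + 1) ≤ a k - b k ^ 2)
    (hab : ∀ k < r, a k ≤ m * b k) :
    ∀ k ≤ r, k * a k ≤ m ^ 2 := by
  intro k
  induction k with
  | zero => intro _; simp only [Nat.cast_zero, zero_mul]; positivity
  | succ k ih =>
    intro hk
    have h1 := ih (by omega)
    have h2 := hstep k (by omega)
    have h3 := hab k (by omega)
    have hk0 : (0 : ℝ) ≤ k := k.cast_nonneg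
    push_cast
    rcases hm.eq_or_lt with rfl | hm'
    · have h4 : a (k + 1) ≤ 0 := by nlinarith [sq_nonneg (b k)]
      nlinarith
    · have hm2 : 0 < m ^ 2 := by positivity
      have h5 : a k ^ 2 ≤ m ^ 2 * b k ^ 2 := by
        rw [← mul_pow]; exact pow_le_pow_left₀ (ha k) h3 2
      have h6 : m ^ 2 * a (k + 1) ≤ a k * (m ^ 2 - a k) := by nlinarith
      have h7 : (k + 1) * (a k * (m ^ 2 - a k)) ≤ m ^ 2 * m ^ 2 := by
        rcases le_total (a k) (m ^ 2) with h | h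
        · nlinarith [mul_le_mul_of_nonneg_right h1 (sub_nonneg.2 h), sq_nonneg (a k)]
        · have : a k * (m ^ 2 - a k) ≤ 0 :=
            mul_nonpos_of_nonneg_of_nonpos (ha k) (by linarith)
          nlinarith [mul_nonneg hm2.le hm2.le]
      have h8 : m ^ 2 * ((k + 1) * a (k + 1)) ≤ m ^ 2 * m ^ 2 := by
        nlinarith [mul_le_mul_of_nonneg_left h6 (by linarith : (0 : ℝ) ≤ k + 1)]
      exact le_of_mul_le_mul_left h8 hm2

section Greedy

variable {H : Type*} [NormedAddCommGroup H] [InnerProductSpace ℝ H]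

lemma IsOGA.norm_sq_succ_le {θ : ℝ} {D : Set H} {f : H} {r : ℕ} {g F : ℕ → H}
    (h : IsOGA θ D f r g F) (hD : ∀ d ∈ D, ‖d‖ ≤ 1) {k : ℕ} (hk : k < r) :
    ‖f - F (k + 1)‖ ^ 2 ≤ ‖f - F k‖ ^ 2 - |inner ℝ (f - F k) (g k)| ^ 2 := by
  have hF' := h.approx_mem (k + 1) hk
  have hF := Submodule.span_mono (R := ℝ) (image_mono (f := g) (Iio_subset_Iio k.le_succ))
    (h.approx_mem k hk.le)
  have hg : g k ∈ Submodule.span ℝ (g '' Iio (k + 1)) :=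
    Submodule.subset_span (mem_image_of_mem g (mem_Iio.2 k.lt_succ_self))
  have hperp := h.residual_orthogonal (k + 1) hk
  have hsplit : f - F k = (f - F (k + 1)) + (F (k + 1) - F k) := by abel
  have hpyth : ‖f - F k‖ ^ 2 = ‖f - F (k + 1)‖ ^ 2 + ‖F (k + 1) - F k‖ ^ 2 := by
    rw [hsplit, norm_add_sq_real, hperp _ (Submodule.sub_mem _ hF' hF)]
    ring
  have hinner : |inner ℝ (f - F k) (g k)| ≤ ‖F (k + 1) - F k‖ := by
    rw [hsplit, inner_add_left, hperp _ hg, zero_add]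
    refine (abs_real_inner_le_norm _ _).trans ?_
    exact mul_le_of_le_one_right (norm_nonneg _) (hD _ (h.atom_mem k hk))
  have := pow_le_pow_left₀ (abs_nonneg _) hinner 2
  linarith

/-- Rate of the weak orthogonal greedy algorithm. The hypothesis `hf` is the dual form of `f` having
variation norm at most `M` with respect to the dictionary `D`. -/
theorem IsOGA.norm_sub_le {θ : ℝ} {D : Set H} {f : H} {r : ℕ} {g F : ℕ → H}
    (h : IsOGA θ D f r g F) (hθ : 0 < θ) (hr : 1 ≤ r) (hD : ∀ d ∈ D, ‖d‖ ≤ 1) {M : ℝ}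
    (hM : 0 ≤ M)
    (hf : ∀ (v : H) (S : ℝ), (∀ d ∈ D, |inner ℝ v d| ≤ S) → 0 ≤ S → inner ℝ v f ≤ M * S) :
    ‖f - F r‖ ≤ M / θ / Real.sqrt r := by
  have hr0 : (0 : ℝ) < r := by exact_mod_cast hr
  have key := mul_le_sq_of_greedy_recursion (a := fun k => ‖f - F k‖ ^ 2)
    (b := fun k => |inner ℝ (f - F k) (g k)|) (m := M / θ) (r := r) (by positivity)
    (fun k => by positivity) (fun k hk => h.norm_sq_succ_le hD hk) (fun k hk => by
      have h1 := hf (f - F k) (|inner ℝ (f - F k) (g k)| / θ) (fun d hd => by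
        rw [le_div_iff₀ hθ, mul_comm]
        exact h.greedy k hk d hd) (by positivity)
      have h2 : ‖f - F k‖ ^ 2 = inner ℝ (f - F k) f := by
        rw [← real_inner_self_eq_norm_sq, inner_sub_right,
          h.residual_orthogonal k hk.le _ (h.approx_mem k hk.le), sub_zero]
      rw [h2]
      exact h1.trans (le_of_eq (by ring))) r le_rfl
  rw [le_div_iff₀ (Real.sqrt_pos.2 hr0)]
  refine le_of_sq_le_sq ?_ (by positivity)
  rw [mul_pow, Real.sq_sqrt hr0.le]
  linarith

lemma exists_weak_greedy_atom {θ : ℝ} (hθ1 : θ < 1) {D : Set H}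
    (hD : ∀ d ∈ D, ‖d‖ ≤ 1) (hne : D.Nonempty) (v : H) :
    ∃ g ∈ D, ∀ d ∈ D, θ * |inner ℝ v d| ≤ |inner ℝ v g| := by
  by_contra! hcon
  obtain ⟨d₀, hd₀⟩ := hne
  have hbdd : BddAbove ((fun d => |inner ℝ v d|) '' D) := by
    refine ⟨‖v‖, ?_⟩
    rintro _ ⟨d, hd, rfl⟩
    exact (abs_real_inner_le_norm _ _).trans (mul_le_of_le_one_right (norm_nonneg _) (hD d hd))
  set s := sSup ((fun d => |inner ℝ v d|) '' D) with hs
  have hle : ∀ d ∈ D, |inner ℝ v d| ≤ s := fun d hd => le_csSup hbdd (mem_image_of_mem _ hd)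
  obtain ⟨d₁, hd₁, h₁⟩ := hcon d₀ hd₀
  have hpos : 0 < s := by
    refine lt_of_lt_of_le (lt_of_le_of_ne (abs_nonneg _) fun h0 => ?_) (hle d₁ hd₁)
    rw [← h0, mul_zero] at h₁
    exact absurd h₁ (abs_nonneg _).not_gt
  have hlt : max θ 0 * s < s := by
    have : max θ 0 < 1 := max_lt hθ1 one_pos
    nlinarith
  obtain ⟨_, ⟨g, hg, rfl⟩, hgs⟩ := exists_lt_of_lt_csSup ⟨_, mem_image_of_mem _ hd₀⟩ hlt
  obtain ⟨d, hd, h⟩ := hcon g hg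
  have h2 : θ * |inner ℝ v d| ≤ max θ 0 * s :=
    mul_le_mul (le_max_left _ _) (hle d hd) (abs_nonneg _) (le_max_right _ _)
  simp only at hgs
  linarith

theorem exists_isOGA {θ : ℝ} (hθ1 : θ < 1) {D : Set H}
    (hD : ∀ d ∈ D, ‖d‖ ≤ 1) (hne : D.Nonempty) (f : H) (r : ℕ) :
    ∃ g F : ℕ → H, IsOGA θ D f r g F := by
  induction r with
  | zero =>
    refine ⟨0, 0, ⟨by simp, by simp, by simp, ?_⟩⟩
    intro k hk v hv
    obtain rfl : k = 0 := by omega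
    have : v = 0 := by simpa using hv
    simp [this]
  | succ r ih =>
    obtain ⟨g, F, h⟩ := ih
    obtain ⟨d, hd, hgreedy⟩ := exists_weak_greedy_atom hθ1 hD hne (f - F r)
    have himg : ∀ k ≤ r, Function.update g r d '' Iio k = g '' Iio k := fun k hk =>
      image_congr fun i hi => Function.update_of_ne (by have := mem_Iio.1 hi; omega) _ _
    let V := Submodule.span ℝ (Function.update g r d '' Iio (r + 1))
    have : FiniteDimensional ℝ V := FiniteDimensional.span_of_finite ℝ ((finite_Iio _).image _)
    refine ⟨Function.update g r d, Function.update F (r + 1) (V.starProjection f), ⟨?_, ?_, ?_, ?_⟩⟩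
    · intro k hk
      by_cases hkr : k = r
      · subst hkr; simpa using hd
      · simpa [hkr] using h.atom_mem k (by omega)
    · intro k hk e he
      rw [Function.update_of_ne (show k ≠ r + 1 by omega)]
      by_cases hkr : k = r
      · subst hkr; simpa using hgreedy e he
      · simpa [hkr] using h.greedy k (by omega) e he
    · intro k hk
      by_cases hkr : k = r + 1
      · subst hkr
        rw [Function.update_self]
        exact V.starProjection_apply_mem f
      · rw [Function.update_of_ne hkr, himg k (by omega)]
        exact h.approx_mem k (by omega)
    · intro k hk
      by_cases hkr : k = r + 1
      · subst hkr
        intro v hv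
        simpa using V.starProjection_inner_eq_zero f v hv
      · rw [Function.update_of_ne hkr, himg k (by omega)]
        exact h.residual_orthogonal k (by omega)

end Greedy

/-! ### Testing the weak derivative against products -/

lemma partialDeriv_prod {p : ℕ} {u : Fin p → ℝ → ℝ} (hu : ∀ i, Differentiable ℝ (u i))
    (j : Fin p) :
    partialDeriv j (fun x => ∏ i, u i (x i)) =
      fun x => ∏ i, Function.update u j (deriv (u j)) i (x i) := by
  funext x
  have hdiff : DifferentiableAt ℝ (fun x : Fin p → ℝ => ∏ i, u i (x i)) x := by
    have h : ∀ i ∈ Finset.univ, DifferentiableAt ℝ (fun x : Fin p → ℝ => u i (x i)) x :=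
      fun i _ => (hu i).differentiableAt.comp x (differentiableAt_apply i x)
    exact (HasFDerivAt.finsetProd fun i hi => (h i hi).hasFDerivAt).differentiableAt
  rw [partialDeriv, ← hdiff.lineDeriv_eq_fderiv, lineDeriv]
  have hline : (fun t : ℝ => ∏ i, u i ((x + t • (Pi.single j 1 : Fin p → ℝ)) i)) =
      fun t => u j (x j + t) * ∏ i ∈ Finset.univ.erase j, u i (x i) := by
    funext t
    rw [← Finset.mul_prod_erase _ _ (Finset.mem_univ j)]
    congr 1
    · simp
    · refine Finset.prod_congr rfl fun i hi => ?_
      simp [Finset.ne_of_mem_erase hi]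
  rw [hline, deriv_mul_const, deriv_comp_const_add, add_zero,
    ← Finset.mul_prod_erase _ _ (Finset.mem_univ j), Function.update_self]
  · congr 1
    refine Finset.prod_congr rfl fun i hi => ?_
    rw [Function.update_of_ne (Finset.ne_of_mem_erase hi)]
  · exact (hu j).differentiableAt.comp _ (by fun_prop)

lemma foldr_partialDeriv_prod {p : ℕ} {u : Fin p → ℝ → ℝ}
    (hu : ∀ i, ContDiff ℝ (⊤ : ℕ∞) (u i)) {l : List (Fin p)} (hl : l.Nodup) :
    l.foldr partialDeriv (fun x => ∏ i, u i (x i)) =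
      fun x => ∏ i, (if i ∈ l then deriv (u i) else u i) (x i) := by
  induction l with
  | nil => simp
  | cons j l ih =>
    obtain ⟨hj, hl⟩ := List.nodup_cons.1 hl
    rw [List.foldr_cons, ih hl, partialDeriv_prod]
    · funext x
      refine Finset.prod_congr rfl fun i _ => ?_
      by_cases hi : i = j
      · subst hi; simp [hj]
      · simp [hi]
    · intro i
      split_ifs
      · exact (contDiff_infty_iff_deriv.1 (hu i)).2.differentiable (by simp)
      · exact (hu i).differentiable (by simp)

lemma mixedPartial_univ_prod {p : ℕ} {u : Fin p → ℝ → ℝ}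
    (hu : ∀ i, ContDiff ℝ (⊤ : ℕ∞) (u i)) :
    mixedPartial Finset.univ (fun x => ∏ i, u i (x i)) = fun x => ∏ i, deriv (u i) (x i) := by
  rw [mixedPartial, foldr_partialDeriv_prod hu ((List.nodup_finRange p).filter _)]
  simp

lemma isTestFunction_prod {p : ℕ} {u : Fin p → ℝ → ℝ}
    (hu : ∀ i, ContDiff ℝ (⊤ : ℕ∞) (u i))
    (h0 : ∀ i, ∃ δ > 0, ∀ t ≤ δ, u i t = 0) (h1 : ∀ i, ∃ δ > 0, ∀ t, 1 - δ ≤ t → u i t = 0) :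
    IsTestFunction fun x : Fin p → ℝ => ∏ i, u i (x i) := by
  choose a ha0 ha using h0
  choose b hb0 hb using h1
  have hsub : tsupport (fun x : Fin p → ℝ => ∏ i, u i (x i)) ⊆
      univ.pi fun i => Icc (a i) (1 - b i) := by
    refine closure_minimal (fun x hx i _ => ?_) (isClosed_set_pi fun i _ => isClosed_Icc)
    have hne : u i (x i) ≠ 0 := fun h => hx (Finset.prod_eq_zero (Finset.mem_univ i) h)
    constructor <;> by_contra! hlt
    · exact hne (ha i _ hlt.le)
    · exact hne (hb i _ hlt.le)
  refine ⟨?_, ?_, ?_⟩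
  · exact contDiff_prod fun i _ => (hu i).comp (contDiff_apply ℝ ℝ i)
  · exact (isCompact_univ_pi fun i => isCompact_Icc).of_isClosed_subset (isClosed_tsupport _) hsub
  · refine hsub.trans (pi_mono fun i _ t ht => ?_)
    exact ⟨(ha0 i).trans_le ht.1, ht.2.trans_lt (by linarith [hb0 i])⟩

/-- A smooth cutoff at the origin: it vanishes for `t ≤ (n + 1)⁻¹` and equals `1` for
`t ≥ 2 (n + 1)⁻¹`. -/
noncomputable def originCutoff (n : ℕ) (t : ℝ) : ℝ := Real.smoothTransition ((n + 1) * t - 1)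

lemma contDiff_originCutoff (n : ℕ) : ContDiff ℝ (⊤ : ℕ∞) (originCutoff n) :=
  Real.smoothTransition.contDiff.comp (by fun_prop)

lemma abs_originCutoff_le_one (n : ℕ) (t : ℝ) : |originCutoff n t| ≤ 1 := by
  rw [originCutoff, abs_of_nonneg (Real.smoothTransition.nonneg _)]
  exact Real.smoothTransition.le_one _

lemma originCutoff_eq_zero {n : ℕ} {t : ℝ} (ht : t ≤ ((n : ℝ) + 1)⁻¹) : originCutoff n t = 0 := by
  have hn : (0 : ℝ) < n + 1 := by positivity
  refine Real.smoothTransition.zero_of_nonpos ?_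
  have := mul_le_mul_of_nonneg_left ht hn.le
  rw [mul_inv_cancel₀ hn.ne'] at this
  linarith

lemma originCutoff_eq_one {n : ℕ} {t : ℝ} (ht : 2 * ((n : ℝ) + 1)⁻¹ ≤ t) :
    originCutoff n t = 1 := by
  have hn : (0 : ℝ) < n + 1 := by positivity
  refine Real.smoothTransition.one_of_one_le ?_
  have := mul_le_mul_of_nonneg_left ht hn.le
  rw [mul_left_comm, mul_inv_cancel₀ hn.ne'] at this
  linarith

lemma tendsto_two_mul_inv_nat_add_one :
    Tendsto (fun n : ℕ => 2 * ((n : ℝ) + 1)⁻¹) atTop (𝓝[>] 0) := by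
  refine tendsto_nhdsWithin_iff.2 ⟨?_, Eventually.of_forall fun n => ?_⟩
  · simpa [one_div] using (tendsto_one_div_add_atTop_nhds_zero_nat (𝕜 := ℝ)).const_mul 2
  · simp only [mem_Ioi]; positivity

lemma tendsto_originCutoff {t : ℝ} (ht : 0 < t) :
    Tendsto (fun n => originCutoff n t) atTop (𝓝 1) := by
  have h := tendsto_two_mul_inv_nat_add_one.mono_right nhdsWithin_le_nhds
  refine tendsto_const_nhds.congr' ?_
  filter_upwards [h.eventually (ge_mem_nhds ht)] with n hn
  exact (originCutoff_eq_one hn).symm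

lemma deriv_originCutoff_eq_zero {n : ℕ} {t : ℝ} (ht : 2 * ((n : ℝ) + 1)⁻¹ < t) :
    deriv (originCutoff n) t = 0 := by
  have : originCutoff n =ᶠ[𝓝 t] fun _ => 1 := by
    filter_upwards [lt_mem_nhds ht] with s hs using originCutoff_eq_one (le_of_lt hs)
  rw [this.deriv_eq, deriv_const]

lemma exists_abs_deriv_originCutoff_le :
    ∃ B, 0 ≤ B ∧ ∀ (n : ℕ), ∀ t, |deriv (originCutoff n) t| ≤ B * (n + 1) := by
  have hcont : Continuous (deriv Real.smoothTransition) :=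
    (Real.smoothTransition.contDiff (n := 1)).continuous_deriv le_rfl
  have hsupp : ∀ s, s ∉ Icc (0 : ℝ) 1 → deriv Real.smoothTransition s = 0 := by
    intro s hs
    rcases lt_or_ge s 0 with h | h
    · have : Real.smoothTransition =ᶠ[𝓝 s] fun _ => 0 := by
        filter_upwards [gt_mem_nhds h] with x hx
          using Real.smoothTransition.zero_of_nonpos (le_of_lt hx)
      rw [this.deriv_eq, deriv_const]
    · have h1 : 1 < s := by by_contra! h1; exact hs ⟨h, h1⟩
      have : Real.smoothTransition =ᶠ[𝓝 s] fun _ => 1 := by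
        filter_upwards [lt_mem_nhds h1] with x hx
          using Real.smoothTransition.one_of_one_le (le_of_lt hx)
      rw [this.deriv_eq, deriv_const]
  obtain ⟨B, hB⟩ := (isCompact_Icc (a := (0 : ℝ)) (b := 1)).exists_bound_of_continuousOn
    hcont.continuousOn
  have hB0 : 0 ≤ B := (norm_nonneg _).trans (hB 0 (by simp))
  have hB' : ∀ s, |deriv Real.smoothTransition s| ≤ B := by
    intro s
    by_cases hs : s ∈ Icc (0 : ℝ) 1
    · exact hB s hs
    · rw [hsupp s hs, abs_zero]; exact hB0
  refine ⟨B, hB0, fun n t => ?_⟩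
  have hn : (0 : ℝ) < n + 1 := by positivity
  have hd : HasDerivAt (originCutoff n)
      (deriv Real.smoothTransition ((n + 1) * t - 1) * (n + 1)) t := by
    refine HasDerivAt.comp t (h₂ := Real.smoothTransition) ?_ ?_
    · exact ((Real.smoothTransition.contDiff (n := 1)).differentiable
        (by simp)).differentiableAt.hasDerivAt
    · simpa using ((hasDerivAt_id t).const_mul ((n : ℝ) + 1)).sub_const 1
  rw [hd.deriv, abs_mul, abs_of_pos hn]
  exact mul_le_mul_of_nonneg_right (hB' _) hn.le

lemma tendsto_integral_mul_originCutoff {p : ℕ} (j : Fin p) {h G : (Fin p → ℝ) → ℝ}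
    (hh : IntegrableOn h (unitCube p)) (hG : Continuous G) :
    Tendsto (fun n => ∫ x in unitCube p, h x * (originCutoff n (x j) * G x)) atTop
      (𝓝 (∫ x in unitCube p, h x * G x)) := by
  have hint : IntegrableOn (fun x => h x * G x) (unitCube p) :=
    hh.mul_continuousOn hG.continuousOn isCompact_Icc
  refine tendsto_integral_of_dominated_convergence (fun x => |h x * G x|) ?_ hint.abs ?_ ?_
  · intro n
    refine (hh.mul_continuousOn (Continuous.continuousOn ?_) isCompact_Icc).aestronglyMeasurable
    exact ((contDiff_originCutoff n).continuous.comp (continuous_apply j)).mul hG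
  · refine fun n => Eventually.of_forall fun x => ?_
    rw [Real.norm_eq_abs, mul_left_comm, abs_mul]
    exact mul_le_of_le_one_left (abs_nonneg _) (abs_originCutoff_le_one _ _)
  · have hne : ∀ᵐ x ∂(volume.restrict (unitCube p)), x j ≠ 0 := by
      refine ae_restrict_of_ae ?_
      exact Measure.ae_eval_ne (μ := fun _ : Fin p => (volume : Measure ℝ)) j 0
    filter_upwards [hne, ae_restrict_mem (measurableSet_Icc (a := (0 : Fin p → ℝ)) (b := 1))]
      with x hx hmem
    have hpos : 0 < x j := lt_of_le_of_ne (hmem.1 j) (Ne.symm hx)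
    simpa using ((tendsto_originCutoff hpos).mul_const (G x)).const_mul (h x)

/-- The boundary term of the cutoff at a face of the cube vanishes in the limit: this is where the
zero trace enters. -/
lemma AnchoredAtZero.tendsto_integral_deriv_originCutoff {p : ℕ} {f : (Fin p → ℝ) → ℝ}
    (hf0 : AnchoredAtZero f) (hf : IntegrableOn f (unitCube p)) (j : Fin p)
    {G : (Fin p → ℝ) → ℝ} (hG : Continuous G) :
    Tendsto (fun n => ∫ x in unitCube p, f x * (deriv (originCutoff n) (x j) * G x)) atTop
      (𝓝 0) := by
  obtain ⟨B, hB0, hB⟩ := exists_abs_deriv_originCutoff_le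
  obtain ⟨C, hC⟩ := (isCompact_Icc (a := (0 : Fin p → ℝ)) (b := 1)).exists_bound_of_continuousOn
    hG.continuousOn
  have hlim := ((hf0 j).comp tendsto_two_mul_inv_nat_add_one).const_mul (2 * B * C)
  rw [mul_zero] at hlim
  refine squeeze_zero_norm (fun n => ?_) hlim
  have hn : (0 : ℝ) < n + 1 := by positivity
  set ε : ℝ := 2 * ((n : ℝ) + 1)⁻¹ with hε
  have hms : MeasurableSet {x : Fin p → ℝ | x j ≤ ε} :=
    measurableSet_le (measurable_pi_apply j) measurable_const
  have hint : IntegrableOn (fun x => B * (n + 1) * C * |f x|) (unitCube p) := hf.abs.const_mul _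
  have hle : ‖∫ x in unitCube p, f x * (deriv (originCutoff n) (x j) * G x)‖ ≤
      ∫ x in unitCube p, {x : Fin p → ℝ | x j ≤ ε}.indicator
        (fun x => B * (n + 1) * C * |f x|) x := by
    refine norm_integral_le_of_norm_le (hint.indicator hms) ?_
    filter_upwards [ae_restrict_mem (measurableSet_Icc (a := (0 : Fin p → ℝ)) (b := 1))]
      with x hmem
    by_cases hx : x j ≤ ε
    · rw [indicator_of_mem (show x ∈ {x : Fin p → ℝ | x j ≤ ε} from hx), Real.norm_eq_abs, abs_mul,
        abs_mul, mul_comm]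
      refine mul_le_mul_of_nonneg_right ?_ (abs_nonneg _)
      exact mul_le_mul (hB n _) (hC x hmem) (abs_nonneg _) (by positivity)
    · rw [indicator_of_notMem (show x ∉ {x : Fin p → ℝ | x j ≤ ε} from hx),
        deriv_originCutoff_eq_zero (not_le.1 hx)]
      simp
  refine hle.trans (le_of_eq ?_)
  rw [setIntegral_indicator hms, integral_const_mul]
  change _ = 2 * B * C * (ε⁻¹ * ∫ x in unitCube p ∩ {x : Fin p → ℝ | x j ≤ ε}, |f x|)
  rw [hε]
  field_simp

/-- For an anchored function, integration by parts against a product is valid as soon as each factor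
vanishes near `1`; factors with index in `T` need not vanish near `0`. The restriction at `0` is
removed one variable at a time, so that only one cutoff is singular in each limit. -/
theorem AnchoredAtZero.integral_mul_prod_deriv {p : ℕ} {f c : (Fin p → ℝ) → ℝ}
    (hf0 : AnchoredAtZero f) (hc : IsWeakMixedDeriv Finset.univ f c) (T : Finset (Fin p)) :
    ∀ u : Fin p → ℝ → ℝ, (∀ i, ContDiff ℝ (⊤ : ℕ∞) (u i)) →
      (∀ i, ∃ δ > 0, ∀ t, 1 - δ ≤ t → u i t = 0) →
      (∀ i ∉ T, ∃ δ > 0, ∀ t ≤ δ, u i t = 0) →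
      ∫ x in unitCube p, f x * ∏ i, deriv (u i) (x i) =
        (-1) ^ p * ∫ x in unitCube p, c x * ∏ i, u i (x i) := by
  induction T using Finset.induction_on with
  | empty =>
    intro u hu h1 h0
    have := hc.integral_eq _ (isTestFunction_prod hu (fun i => h0 i (by simp)) h1)
    rwa [mixedPartial_univ_prod hu, Finset.card_univ, Fintype.card_fin] at this
  | insert j T hj ih =>
    intro u hu h1 h0
    let v : ℕ → Fin p → ℝ → ℝ := fun n =>
      Function.update u j fun t => originCutoff n t * u j t
    have hv : ∀ n, ∫ x in unitCube p, f x * ∏ i, deriv (v n i) (x i) =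
        (-1) ^ p * ∫ x in unitCube p, c x * ∏ i, v n i (x i) := by
      intro n
      refine ih (v n) (fun i => ?_) (fun i => ?_) (fun i hi => ?_) <;>
        by_cases hij : i = j
      · subst hij
        simpa [v] using (contDiff_originCutoff n).mul (hu i)
      · simpa [v, hij] using hu i
      · subst hij
        obtain ⟨δ, hδ, h⟩ := h1 i
        exact ⟨δ, hδ, fun t ht => by simp [v, h t ht]⟩
      · simpa [v, hij] using h1 i
      · subst hij
        refine ⟨((n : ℝ) + 1)⁻¹, by positivity, fun t ht => ?_⟩
        simp [v, originCutoff_eq_zero ht]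
      · simpa [v, hij] using h0 i (by simp [hij, hi])
    have hcont : ∀ i, Continuous (u i) := fun i => (hu i).continuous
    have hcont' : ∀ i, Continuous (deriv (u i)) := fun i =>
      (hu i).continuous_deriv (by exact_mod_cast le_top)
    let R : (Fin p → ℝ) → ℝ := fun x => ∏ i ∈ Finset.univ.erase j, deriv (u i) (x i)
    have hR : Continuous R :=
      continuous_finsetProd _ fun i _ => (hcont' i).comp (continuous_apply i)
    have hG : Continuous fun x : Fin p → ℝ => ∏ i, u i (x i) :=
      continuous_finsetProd _ fun i _ => (hcont i).comp (continuous_apply i)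
    have hG' : Continuous fun x : Fin p → ℝ => ∏ i, deriv (u i) (x i) :=
      continuous_finsetProd _ fun i _ => (hcont' i).comp (continuous_apply i)
    have hGj : Continuous fun x : Fin p → ℝ => u j (x j) * R x :=
      ((hcont j).comp (continuous_apply j)).mul hR
    have hprod : ∀ (n : ℕ) (x : Fin p → ℝ),
        ∏ i, v n i (x i) = originCutoff n (x j) * ∏ i, u i (x i) := by
      intro n x
      rw [← Finset.mul_prod_erase _ _ (Finset.mem_univ j),
        ← Finset.mul_prod_erase _ (fun i => u i (x i)) (Finset.mem_univ j), ← mul_assoc]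
      congr 1
      · simp [v]
      · refine Finset.prod_congr rfl fun i hi => ?_
        simp [v, Finset.ne_of_mem_erase hi]
    have hprod' : ∀ (n : ℕ) (x : Fin p → ℝ), ∏ i, deriv (v n i) (x i) =
        originCutoff n (x j) * (∏ i, deriv (u i) (x i)) +
          deriv (originCutoff n) (x j) * (u j (x j) * R x) := by
      intro n x
      rw [← Finset.mul_prod_erase _ _ (Finset.mem_univ j),
        ← Finset.mul_prod_erase _ (fun i => deriv (u i) (x i)) (Finset.mem_univ j)]
      have h2 : ∏ i ∈ Finset.univ.erase j, deriv (v n i) (x i) = R x := by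
        refine Finset.prod_congr rfl fun i hi => ?_
        simp [v, Finset.ne_of_mem_erase hi]
      have h3 : deriv (v n j) (x j) =
          deriv (originCutoff n) (x j) * u j (x j) + originCutoff n (x j) * deriv (u j) (x j) := by
        simp only [v, Function.update_self]
        exact deriv_fun_mul ((contDiff_originCutoff n).differentiable (by simp)).differentiableAt
          ((hu j).differentiable (by simp)).differentiableAt
      rw [h2, h3]
      change _ = originCutoff n (x j) * (_ * R x) + _
      ring
    have hη : ∀ n, Continuous fun x : Fin p → ℝ => originCutoff n (x j) := fun n =>
      (contDiff_originCutoff n).continuous.comp (continuous_apply j)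
    have hη' : ∀ n, Continuous fun x : Fin p → ℝ => deriv (originCutoff n) (x j) := fun n =>
      ((contDiff_originCutoff n).continuous_deriv (by exact_mod_cast le_top)).comp
        (continuous_apply j)
    have hL : Tendsto (fun n => ∫ x in unitCube p, f x * ∏ i, deriv (v n i) (x i)) atTop
        (𝓝 (∫ x in unitCube p, f x * ∏ i, deriv (u i) (x i))) := by
      have := (tendsto_integral_mul_originCutoff j hc.integrableOn hG').add
        (hf0.tendsto_integral_deriv_originCutoff hc.integrableOn j hGj)
      rw [add_zero] at this
      refine this.congr fun n => ?_
      rw [← integral_add]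
      · refine integral_congr_ae (Eventually.of_forall fun x => ?_)
        simp only [hprod', mul_add]
      · exact hc.integrableOn.mul_continuousOn ((hη n).mul hG').continuousOn isCompact_Icc
      · exact hc.integrableOn.mul_continuousOn ((hη' n).mul hGj).continuousOn isCompact_Icc
    have hRt := (tendsto_integral_mul_originCutoff j hc.integrableOn_deriv hG).const_mul
      ((-1 : ℝ) ^ p)
    refine tendsto_nhds_unique hL (hRt.congr fun n => ?_)
    rw [hv n]
    simp only [hprod]

/-! ### Representation by the cumulative integral of the mixed derivative -/

/-- The function `x ↦ ∫_{[0,x]} c(y) dy` on the unit cube. -/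
noncomputable def cumulativeIntegral {p : ℕ} (c : (Fin p → ℝ) → ℝ) (x : Fin p → ℝ) : ℝ :=
  ∫ y in unitCube p, (Iic x).indicator c y

lemma abs_cumulativeIntegral_le {p : ℕ} {c : (Fin p → ℝ) → ℝ} (hc : IntegrableOn c (unitCube p))
    (x : Fin p → ℝ) : |cumulativeIntegral c x| ≤ ∫ y in unitCube p, |c y| := by
  rw [← Real.norm_eq_abs, cumulativeIntegral]
  refine norm_integral_le_of_norm_le hc.abs (Eventually.of_forall fun y => ?_)
  exact norm_indicator_le_norm_self _ _

/-- The joint kernel `(x, y) ↦ v(x) 1_{y ≤ x} c(y)` is integrable. -/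
lemma integrable_mul_indicator_Iic {p : ℕ} {μ : Measure (Fin p → ℝ)} [SFinite μ]
    {c v : (Fin p → ℝ) → ℝ} (hc : IntegrableOn c (unitCube p)) (hv : Integrable v μ) :
    Integrable (fun z : (Fin p → ℝ) × (Fin p → ℝ) => v z.1 * (Iic z.1).indicator c z.2)
      (μ.prod (volume.restrict (unitCube p))) := by
  have hprod : Integrable (fun z : (Fin p → ℝ) × (Fin p → ℝ) => v z.1 * c z.2)
      (μ.prod (volume.restrict (unitCube p))) := hv.mul_prod hc
  have h := hprod.indicator (s := {z : (Fin p → ℝ) × (Fin p → ℝ) | z.2 ≤ z.1})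
    (measurableSet_le measurable_snd measurable_fst)
  refine h.congr (Eventually.of_forall fun z => ?_)
  by_cases hz : z.2 ≤ z.1 <;> simp [indicator, hz]

lemma integral_mul_cumulativeIntegral {p : ℕ} {μ : Measure (Fin p → ℝ)} [SFinite μ]
    {c v : (Fin p → ℝ) → ℝ} (hc : IntegrableOn c (unitCube p)) (hv : Integrable v μ) :
    ∫ x, v x * cumulativeIntegral c x ∂μ =
      ∫ y in unitCube p, c y * ∫ x in Ici y, v x ∂μ := by
  have h := integral_integral_swap (f := fun x y => v x * (Iic x).indicator c y)
    (integrable_mul_indicator_Iic hc hv)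
  simp only [integral_const_mul] at h
  refine h.trans (integral_congr_ae (Eventually.of_forall fun y => ?_))
  simp only
  rw [← integral_indicator measurableSet_Ici, ← integral_const_mul]
  refine integral_congr_ae (Eventually.of_forall fun x => ?_)
  by_cases hz : y ≤ x <;> simp [indicator, hz, mul_comm]

lemma integrableOn_cumulativeIntegral {p : ℕ} {c : (Fin p → ℝ) → ℝ}
    (hc : IntegrableOn c (unitCube p)) :
    IntegrableOn (cumulativeIntegral c) (unitCube p) := by
  have h1 : IntegrableOn (fun _ : Fin p → ℝ => (1 : ℝ)) (unitCube p) :=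
    integrableOn_const isCompact_Icc.measure_lt_top.ne
  have h := (integrable_mul_indicator_Iic hc h1).integral_prod_left
  simp only [one_mul] at h
  exact h

lemma volume_restrict_unitCube (p : ℕ) :
    (volume : Measure (Fin p → ℝ)).restrict (unitCube p) =
      Measure.pi fun _ => volume.restrict (Icc (0 : ℝ) 1) := by
  rw [unitCube, ← pi_univ_Icc, volume_pi, Measure.restrict_pi_pi]
  rfl

lemma setIntegral_Ici_prod {p : ℕ} {u : Fin p → ℝ → ℝ} {y : Fin p → ℝ} (hy : y ∈ unitCube p) :
    ∫ x in Ici y, ∏ i, u i (x i) ∂(volume.restrict (unitCube p)) =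
      ∏ i, ∫ t in y i..1, u i t := by
  rw [← integral_indicator measurableSet_Ici]
  have h : (Ici y).indicator (fun x => ∏ i, u i (x i)) =
      fun x => ∏ i, (Ici (y i)).indicator (u i) (x i) := by
    funext x
    by_cases hx : y ≤ x
    · rw [indicator_of_mem (mem_Ici.2 hx)]
      exact Finset.prod_congr rfl fun i _ => (indicator_of_mem (mem_Ici.2 (hx i)) _).symm
    · rw [indicator_of_notMem (by simpa using hx)]
      obtain ⟨i, hi⟩ : ∃ i, ¬ y i ≤ x i := by simpa [Pi.le_def] using hx
      exact (Finset.prod_eq_zero (Finset.mem_univ i) 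
        (indicator_of_notMem (s := Ici (y i)) (by simpa using hi) _)).symm
  rw [h, volume_restrict_unitCube,
    integral_fintype_prod_eq_prod (fun i t => (Ici (y i)).indicator (u i) t)]
  refine Finset.prod_congr rfl fun i _ => ?_
  have hset : Icc (0 : ℝ) 1 ∩ Ici (y i) = Icc (y i) 1 := by
    ext t
    have : 0 ≤ y i := hy.1 i
    simp only [mem_inter_iff, mem_Icc, mem_Ici]
    constructor
    · rintro ⟨⟨-, h1⟩, h2⟩; exact ⟨h2, h1⟩
    · rintro ⟨h2, h1⟩; exact ⟨⟨this.trans h2, h1⟩, h2⟩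
  rw [setIntegral_indicator measurableSet_Ici, hset, integral_Icc_eq_integral_Ioc,
    intervalIntegral.integral_of_le (show y i ≤ 1 from hy.2 i)]

lemma contDiff_integral {u : ℝ → ℝ} (hu : ContDiff ℝ (⊤ : ℕ∞) u) (a : ℝ) :
    ContDiff ℝ (⊤ : ℕ∞) fun t => ∫ s in a..t, u s := by
  have hd : ∀ t, HasDerivAt (fun t => ∫ s in a..t, u s) (u t) t := fun t =>
    intervalIntegral.integral_hasDerivAt_right (hu.continuous.intervalIntegrable _ _)
      hu.continuous.stronglyMeasurable.stronglyMeasurableAtFilter hu.continuous.continuousAt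
  refine contDiff_infty_iff_deriv.2 ⟨fun t => (hd t).differentiableAt, ?_⟩
  rwa [show deriv (fun t => ∫ s in a..t, u s) = u from funext fun t => (hd t).deriv]

/-- An anchored function and the cumulative integral of its mixed derivative agree against products
of smooth functions vanishing near `1`. The test functions are the primitives of the factors, which
need not vanish near `0`. -/
lemma AnchoredAtZero.integral_mul_prod_eq {p : ℕ} {f c : (Fin p → ℝ) → ℝ}
    (hf0 : AnchoredAtZero f) (hc : IsWeakMixedDeriv Finset.univ f c) {u : Fin p → ℝ → ℝ}
    (hu : ∀ i, ContDiff ℝ (⊤ : ℕ∞) (u i)) (h1 : ∀ i, ∃ δ > 0, ∀ t, 1 - δ ≤ t → u i t = 0) :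
    ∫ x in unitCube p, f x * ∏ i, u i (x i) =
      ∫ x in unitCube p, cumulativeIntegral c x * ∏ i, u i (x i) := by
  have hderiv : ∀ i, deriv (fun t => ∫ s in (1 : ℝ)..t, u i s) = u i := fun i =>
    funext fun t => (hu i).continuous.deriv_integral _ _ _
  have hcont : Continuous fun x : Fin p → ℝ => ∏ i, u i (x i) :=
    continuous_finsetProd _ fun i _ => (hu i).continuous.comp (continuous_apply i)
  have key := hf0.integral_mul_prod_deriv hc Finset.univ (fun i t => ∫ s in (1 : ℝ)..t, u i s)
    (fun i => contDiff_integral (hu i) 1) (fun i => ?_) (by simp)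
  · simp only [hderiv] at key
    rw [key, ← integral_const_mul]
    have hfub := integral_mul_cumulativeIntegral (μ := volume.restrict (unitCube p))
      hc.integrableOn_deriv (hcont.continuousOn.integrableOn_compact isCompact_Icc)
    rw [integral_congr_ae (Eventually.of_forall fun x => mul_comm (cumulativeIntegral c x) _), hfub]
    refine setIntegral_congr_fun measurableSet_Icc fun y hy => ?_
    rw [setIntegral_Ici_prod hy, mul_left_comm]
    congr 1
    rw [Finset.prod_congr rfl fun i _ => intervalIntegral.integral_symm (1 : ℝ) (y i),
      Finset.prod_neg, Finset.card_univ, Fintype.card_fin]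
  · obtain ⟨δ, hδ, h⟩ := h1 i
    refine ⟨δ, hδ, fun t ht => ?_⟩
    rw [intervalIntegral.integral_congr (g := fun _ => 0), intervalIntegral.integral_zero]
    intro s hs
    refine h s ?_
    rcases le_total 1 t with h' | h'
    · rw [uIcc_of_le h'] at hs; linarith [hs.1]
    · rw [uIcc_of_ge h'] at hs; linarith [hs.1]

lemma ae_eq_zero_of_setIntegral_eq_zero_of_generateFrom {α : Type*} {m : MeasurableSpace α}
    {μ : Measure α} {h : α → ℝ} (hh : Integrable h μ) {C : Set (Set α)}
    (hgen : m = MeasurableSpace.generateFrom C) (hpi : IsPiSystem C)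
    (htot : ∫ x, h x ∂μ = 0) (hC : ∀ s ∈ C, ∫ x in s, h x ∂μ = 0) : h =ᵐ[μ] 0 := by
  suffices hall : ∀ s, MeasurableSet s → ∫ x in s, h x ∂μ = 0 from
    hh.ae_eq_zero_of_forall_setIntegral_eq_zero fun s hs _ => hall s hs
  intro s hs
  induction s, hs using MeasurableSpace.induction_on_inter hgen hpi with
  | empty => simp
  | basic t ht => exact hC t ht
  | compl t htm ih =>
    have := integral_add_compl htm hh
    rw [ih, htot] at this
    linarith
  | iUnion t hd htm ih =>
    rw [integral_iUnion htm hd hh.integrableOn]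
    simp [ih]

lemma generateFrom_pi_Iio (p : ℕ) :
    (MeasurableSpace.pi : MeasurableSpace (Fin p → ℝ)) =
      MeasurableSpace.generateFrom (pi univ '' pi univ fun _ => range (Iio : ℝ → Set ℝ)) := by
  refine (generateFrom_eq_pi (fun _ => ?_) fun _ => ?_).symm
  · rw [← borel_eq_generateFrom_Iio, BorelSpace.measurable_eq (α := ℝ)]
  · refine ⟨fun n : ℕ => Iio (n : ℝ), fun n => mem_range_self _, ?_⟩
    exact iUnion_eq_univ_iff.2 fun t => exists_nat_gt t

/-- An anchored function with integrable mixed derivative `c` is the cumulative integral of `c`. -/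
theorem AnchoredAtZero.ae_eq_cumulativeIntegral {p : ℕ} {f c : (Fin p → ℝ) → ℝ}
    (hf0 : AnchoredAtZero f) (hc : IsWeakMixedDeriv Finset.univ f c) :
    f =ᵐ[volume.restrict (unitCube p)] cumulativeIntegral c := by
  set μ := (volume : Measure (Fin p → ℝ)).restrict (unitCube p) with hμ
  have hF := integrableOn_cumulativeIntegral hc.integrableOn_deriv
  have hh : Integrable (fun x => f x - cumulativeIntegral c x) μ := hc.integrableOn.sub hF
  have hbox : ∀ b : Fin p → ℝ,
      ∫ x in univ.pi fun i => Iio (b i), (f x - cumulativeIntegral c x) ∂μ = 0 := by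
    intro b
    -- Smooth functions converging to the indicator of `t < min (b i) 1`; the truncation at `1`
    -- makes them vanish near `1` and changes the box only in a null set of the cube.
    let u : ℕ → Fin p → ℝ → ℝ := fun n i t => originCutoff n (min (b i) 1 - t)
    have hu : ∀ n i, ContDiff ℝ (⊤ : ℕ∞) (u n i) := fun n i =>
      (contDiff_originCutoff n).comp (by fun_prop)
    have hucont : ∀ n, Continuous fun x : Fin p → ℝ => ∏ i, u n i (x i) := fun n =>
      continuous_finsetProd _ fun i _ => (hu n i).continuous.comp (continuous_apply i)
    have hzero : ∀ n, ∫ x, (∏ i, u n i (x i)) * (f x - cumulativeIntegral c x) ∂μ = 0 := by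
      intro n
      have := hf0.integral_mul_prod_eq hc (hu n) fun i => ⟨((n : ℝ) + 1)⁻¹, by positivity, ?_⟩
      · simp only [mul_comm (∏ i, u n i _), sub_mul]
        rw [integral_sub, this, sub_self]
        · exact hc.integrableOn.mul_continuousOn (hucont n).continuousOn isCompact_Icc
        · exact hF.mul_continuousOn (hucont n).continuousOn isCompact_Icc
      · intro t ht
        exact originCutoff_eq_zero (by linarith [min_le_right (b i) 1])
    have hlt1 : ∀ᵐ x ∂μ, ∀ i, x i ≠ 1 := by
      refine ae_restrict_of_ae (ae_all_iff.2 fun i => ?_)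
      exact Measure.ae_eval_ne (μ := fun _ : Fin p => (volume : Measure ℝ)) i 1
    have hlim : Tendsto (fun n => ∫ x, (∏ i, u n i (x i)) * (f x - cumulativeIntegral c x) ∂μ)
        atTop (𝓝 (∫ x, (univ.pi fun i => Iio (b i)).indicator
          (fun x => f x - cumulativeIntegral c x) x ∂μ)) := by
      refine tendsto_integral_of_dominated_convergence (fun x => |f x - cumulativeIntegral c x|)
        (fun n => ?_) hh.abs (fun n => Eventually.of_forall fun x => ?_) ?_
      · exact (hucont n).aestronglyMeasurable.mul hh.aestronglyMeasurable
      · rw [Real.norm_eq_abs, abs_mul, Finset.abs_prod]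
        refine mul_le_of_le_one_left (abs_nonneg _) ?_
        exact Finset.prod_le_one (fun i _ => abs_nonneg _) fun i _ => abs_originCutoff_le_one _ _
      · filter_upwards [hlt1, ae_restrict_mem (measurableSet_Icc (a := (0 : Fin p → ℝ)) (b := 1))]
          with x hx hmem
        by_cases hxb : x ∈ univ.pi fun i => Iio (b i)
        · rw [indicator_of_mem hxb]
          have : Tendsto (fun n => ∏ i, u n i (x i)) atTop (𝓝 (∏ _i : Fin p, 1)) := by
            refine tendsto_finsetProd _ fun i _ => tendsto_originCutoff ?_
            exact sub_pos.2 (lt_min (hxb i (mem_univ i)) (lt_of_le_of_ne (hmem.2 i) (hx i)))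
          simpa using this.mul_const (f x - cumulativeIntegral c x)
        · rw [indicator_of_notMem hxb]
          obtain ⟨i, hi⟩ : ∃ i, b i ≤ x i := by simpa [Set.mem_pi] using hxb
          refine tendsto_const_nhds.congr fun n => ?_
          rw [Finset.prod_eq_zero (Finset.mem_univ i), zero_mul]
          exact originCutoff_eq_zero (le_trans (by linarith [min_le_left (b i) 1])
            (inv_nonneg.2 (by positivity : (0 : ℝ) ≤ n + 1)))
    rw [integral_indicator (MeasurableSet.univ_pi fun i => measurableSet_Iio)] at hlim
    simp only [hzero] at hlim
    exact (tendsto_nhds_unique tendsto_const_nhds hlim).symm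
  -- The box with upper corner `(2, …, 2)` contains the cube.
  have htot : ∫ x, (f x - cumulativeIntegral c x) ∂μ = 0 := by
    have h := hbox 2
    rw [hμ, Measure.restrict_restrict (MeasurableSet.univ_pi fun i => measurableSet_Iio),
      inter_eq_right.2] at h
    · exact h
    · intro x hx i _
      exact (hx.2 i).trans_lt (by norm_num)
  have := ae_eq_zero_of_setIntegral_eq_zero_of_generateFrom hh (generateFrom_pi_Iio p)
    (IsPiSystem.pi fun _ => isPiSystem_Iio) htot (by
      rintro _ ⟨s, hs, rfl⟩
      choose b hb using fun i => hs i (mem_univ i)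
      have hs' : s = fun i => Iio (b i) := funext fun i => (hb i).symm
      rw [hs']
      exact hbox b)
  filter_upwards [this] with x hx
  exact sub_eq_zero.1 hx

/-! ### Anchored boxes as dictionary elements -/

lemma ae_mem_unitCube {p : ℕ} {P : Measure (Fin p → ℝ)}
    (hP : P ≪ volume.restrict (unitCube p)) : ∀ᵐ x ∂P, x ∈ unitCube p :=
  hP.ae_le (ae_restrict_mem measurableSet_Icc)

lemma isPiecewiseConstant_mul_indicator_Ici (s : ℝ) {a : ℝ} (ha : a ∈ Icc (0 : ℝ) 1) :
    IsPiecewiseConstant fun t => s * (Ici a).indicator 1 t := by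
  refine ⟨2, ![0, s], ![Ico 0 a, Icc a 1], ?_, ?_, ?_⟩
  · intro k
    fin_cases k
    · exact ordConnected_Ico
    · exact ordConnected_Icc
  · ext t
    simp only [mem_iUnion, Fin.exists_fin_two, Matrix.cons_val_zero, Matrix.cons_val_one, mem_Ico,
      mem_Icc]
    constructor
    · rintro (h | h)
      · exact ⟨h.1, h.2.le.trans ha.2⟩
      · exact ⟨ha.1.trans h.1, h.2⟩
    · intro h
      rcases lt_or_ge t a with h' | h'
      · exact Or.inl ⟨h.1, h'⟩
      · exact Or.inr ⟨h', h.2⟩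
  · intro t ht
    rw [Fin.sum_univ_two]
    by_cases h : a ≤ t <;> simp [indicator, h, ht.2]

/-- The class in `L²(P)` of the indicator of `{x | y ≤ x}`; on the unit cube this set is the
box `[y, 1]`. -/
noncomputable def boxIndicator {p : ℕ} (P : Measure (Fin p → ℝ)) [IsFiniteMeasure P]
    (y : Fin p → ℝ) : Lp ℝ 2 P :=
  indicatorConstLp 2 (measurableSet_Ici (a := y)) (measure_ne_top P _) 1

lemma norm_boxIndicator_le_one {p : ℕ} (P : Measure (Fin p → ℝ)) [IsProbabilityMeasure P]
    (y : Fin p → ℝ) : ‖boxIndicator P y‖ ≤ 1 := by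
  rw [boxIndicator, norm_indicatorConstLp (by simp) (by simp), norm_one, one_mul]
  exact Real.rpow_le_one measureReal_nonneg measureReal_le_one (by simp)

lemma norm_boxIndicator_eq_one {p : ℕ} {P : Measure (Fin p → ℝ)} [IsProbabilityMeasure P]
    {y : Fin p → ℝ} (hy : ∀ᵐ x ∂P, y ≤ x) : ‖boxIndicator P y‖ = 1 := by
  have h : P (Ici y) = 1 := prob_compl_eq_zero_iff measurableSet_Ici |>.1 hy
  rw [boxIndicator, norm_indicatorConstLp (by simp) (by simp), measureReal_def, h]
  simp

lemma inv_norm_smul_boxIndicator_mem {p : ℕ} {P : Measure (Fin p → ℝ)} [IsProbabilityMeasure P]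
    {y : Fin p → ℝ} (hy : y ∈ unitCube p) (hne : ‖boxIndicator P y‖ ≠ 0) :
    ‖boxIndicator P y‖⁻¹ • boxIndicator P y ∈ positiveDictionary P := by
  set N := ‖boxIndicator P y‖ with hN
  have hN0 : 0 ≤ N⁻¹ := inv_nonneg.2 (norm_nonneg _)
  -- The normalising constant is spread evenly over the `p` factors; for `p = 0` it is `1`.
  obtain ⟨s, hs0, hs⟩ : ∃ s : ℝ, 0 ≤ s ∧ s ^ p = N⁻¹ := by
    rcases Nat.eq_zero_or_pos p with rfl | hp
    · refine ⟨1, zero_le_one, ?_⟩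
      rw [hN, norm_boxIndicator_eq_one (Eventually.of_forall fun x i => i.elim0)]
      simp
    · exact ⟨N⁻¹ ^ ((p : ℝ)⁻¹), Real.rpow_nonneg hN0 _,
        Real.rpow_inv_natCast_pow hN0 hp.ne'⟩
  refine ⟨fun i t => s * (Ici (y i)).indicator 1 t, fun i =>
    isPiecewiseConstant_mul_indicator_Ici s ⟨hy.1 i, hy.2 i⟩, fun x _ => ?_, ?_, ?_⟩
  · exact Finset.prod_nonneg fun i _ =>
      mul_nonneg hs0 (indicator_nonneg (fun _ _ => zero_le_one) _)
  · filter_upwards [Lp.coeFn_smul N⁻¹ (boxIndicator P y),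
      indicatorConstLp_coeFn (p := 2) (hs := measurableSet_Ici (a := y))
        (hμs := measure_ne_top P _) (c := (1 : ℝ))] with x hx hx'
    rw [hx, Pi.smul_apply, boxIndicator, hx', smul_eq_mul, Finset.prod_mul_distrib,
      Finset.prod_const, Finset.card_univ, Fintype.card_fin, hs]
    congr 1
    by_cases h : y ≤ x
    · rw [indicator_of_mem (mem_Ici.2 h), Finset.prod_eq_one]
      intro i _
      rw [indicator_of_mem (mem_Ici.2 (h i)), Pi.one_apply]
    · rw [indicator_of_notMem (by simpa using h)]
      obtain ⟨i, hi⟩ : ∃ i, ¬ y i ≤ x i := by simpa [Pi.le_def] using h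
      exact (Finset.prod_eq_zero (Finset.mem_univ i)
        (indicator_of_notMem (s := Ici (y i)) (by simpa using hi) _)).symm
  · rw [norm_smul, norm_inv, norm_norm, inv_mul_cancel₀ hne]

lemma positiveDictionary_nonempty {p : ℕ} {P : Measure (Fin p → ℝ)} [IsProbabilityMeasure P]
    (hP : P ≪ volume.restrict (unitCube p)) : (positiveDictionary P).Nonempty := by
  refine ⟨_, inv_norm_smul_boxIndicator_mem (y := 0) ⟨le_rfl, fun _ => zero_le_one⟩ ?_⟩
  rw [norm_boxIndicator_eq_one ((ae_mem_unitCube hP).mono fun x hx => hx.1)]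
  exact one_ne_zero

lemma abs_setIntegral_Ici_le {p : ℕ} {P : Measure (Fin p → ℝ)} [IsProbabilityMeasure P]
    {v : Lp ℝ 2 P} {S : ℝ} (hv : ∀ d ∈ positiveDictionary P, |inner ℝ v d| ≤ S) (hS : 0 ≤ S)
    {y : Fin p → ℝ} (hy : y ∈ unitCube p) : |∫ x in Ici y, v x ∂P| ≤ S := by
  have h : ∫ x in Ici y, v x ∂P = inner ℝ v (boxIndicator P y) := by
    rw [real_inner_comm, boxIndicator, L2.inner_indicatorConstLp_one]
  rw [h]
  by_cases hne : ‖boxIndicator P y‖ = 0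
  · rw [norm_eq_zero.1 hne, inner_zero_right, abs_zero]
    exact hS
  · have h1 := hv _ (inv_norm_smul_boxIndicator_mem hy hne)
    rw [real_inner_smul_right, abs_mul, abs_inv, abs_norm] at h1
    have hpos : 0 < ‖boxIndicator P y‖ := lt_of_le_of_ne (norm_nonneg _) (Ne.symm hne)
    rw [inv_mul_le_iff₀ hpos] at h1
    exact h1.trans (mul_le_of_le_one_left hS (norm_boxIndicator_le_one P y))

/-- A cumulative integral of `c` has variation norm at most `‖c‖₁` with respect to the dictionary,
in the dual form used by the greedy rate. -/
lemma integral_mul_cumulativeIntegral_le {p : ℕ} {P : Measure (Fin p → ℝ)} [IsProbabilityMeasure P]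
    {c : (Fin p → ℝ) → ℝ} (hc : IntegrableOn c (unitCube p)) {v : Lp ℝ 2 P} {S : ℝ}
    (hv : ∀ d ∈ positiveDictionary P, |inner ℝ v d| ≤ S) (hS : 0 ≤ S) :
    ∫ x, v x * cumulativeIntegral c x ∂P ≤ (∫ x in unitCube p, |c x|) * S := by
  rw [integral_mul_cumulativeIntegral hc ((Lp.memLp v).integrable (by norm_num)),
    ← integral_mul_const]
  refine (Real.le_norm_self _).trans (norm_integral_le_of_norm_le (hc.abs.mul_const S) ?_)
  filter_upwards [ae_restrict_mem (measurableSet_Icc (a := (0 : Fin p → ℝ)) (b := 1))] with y hy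
  rw [Real.norm_eq_abs, abs_mul]
  exact mul_le_mul_of_nonneg_left (abs_setIntegral_Ici_le hv hS hy) (abs_nonneg _)

/-! ### The greedy rate for anchored functions of mixed smoothness -/

theorem mainTheorem1 (p : ℕ) (P : Measure (Fin p → ℝ)) [IsProbabilityMeasure P]
    (hP : P ≪ volume.restrict (unitCube p))
    (f c : (Fin p → ℝ) → ℝ) (hf : MemWmix f) (hf0 : AnchoredAtZero f)
    (hc : IsWeakMixedDeriv Finset.univ f c) :
    ∃ hL : MemLp f 2 P,
      ∀ θ ∈ Icc (1 / 2 : ℝ) 1,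
        (θ < 1 → ∀ r : ℕ, ∃ g F : ℕ → Lp ℝ 2 P,
          IsOGA θ (positiveDictionary P) (hL.toLp f) r g F) ∧
        ∀ r : ℕ, 1 ≤ r → ∀ g F : ℕ → Lp ℝ 2 P,
          IsOGA θ (positiveDictionary P) (hL.toLp f) r g F →
            ‖hL.toLp f - F r‖ ≤ 2 * (∫ x in unitCube p, |c x|) / Real.sqrt r := by
  have hfF : f =ᵐ[P] cumulativeIntegral c := hP.ae_eq (hf0.ae_eq_cumulativeIntegral hc)
  have hL : MemLp f 2 P := by
    refine MemLp.of_bound (hc.integrableOn.aestronglyMeasurable.mono_ac hP)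
      (∫ x in unitCube p, |c x|) ?_
    filter_upwards [hfF] with x hx
    rw [hx]
    exact abs_cumulativeIntegral_le hc.integrableOn_deriv x
  have hD : ∀ d ∈ positiveDictionary P, ‖d‖ ≤ 1 := fun d hd => hd.choose_spec.2.2.2.le
  refine ⟨hL, fun θ hθ => ⟨fun hθ1 r =>
    exists_isOGA hθ1 hD (positiveDictionary_nonempty hP) _ r, fun r hr g F hOGA => ?_⟩⟩
  have hθ0 : 0 < θ := lt_of_lt_of_le (by norm_num) hθ.1
  have hM : 0 ≤ ∫ x in unitCube p, |c x| := integral_nonneg fun x => abs_nonneg _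
  have hrate := hOGA.norm_sub_le hθ0 hr hD hM fun v S hv hS => by
    refine le_trans (le_of_eq ?_)
      (integral_mul_cumulativeIntegral_le hc.integrableOn_deriv hv hS)
    rw [L2.inner_def]
    refine integral_congr_ae ?_
    filter_upwards [hL.coeFn_toLp, hfF] with x hx hx'
    rw [hx, hx']
    exact mul_comm _ _
  refine hrate.trans (div_le_div_of_nonneg_right ?_ (Real.sqrt_nonneg _))
  rw [div_le_iff₀ hθ0]
  nlinarith [hθ.1]
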